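/- **Comparison functions.** Let $\mathbb R_+=[0,\infty)$. $\mathcal K$ is the set of continuous, strictly increasing $g:\mathbb R_+\to\mathbb R_+$ with $g(0)=0$; $\mathcal K_\infty$ is the set of unbounded $g\in\mathcal K$; $\mathcal P$ is the set of continuous $\alpha:\mathbb R_+\to\mathbb R_+$ with $\alpha(0)=0$ and $\alpha(r)>0$ for $r>0$; $\mathcal{KL}$ is the set of continuous $\beta:\mathbb R_+\times\mathbb R_+\to\mathbb R_+$ such that $\beta(\cdot,t)\in\mathcal K$ for all $t\ge 0$ and, for all $r>0$, $\beta(r,\cdot)$ is strictly decreasing with limit $0$ at infinity. **Network.** For $i\in\mathbb N$ let $E_i$, $F_i$ be finite-dimensional real normed spaces (that is, $\mathbb R^{n_i}$, $\mathbb R^{m_i}$ with arbitrary norms), let $I_i\subset\mathbb N\setminus\{i\}$ be finite (possibly empty), and let $f_i:E_i\times\prod_{j\in I_i}E_j\times F_i\to E_i$ be continuous. Let $X$ (resp. $U$) be the space of $x\in\prod_iE_i$ with $\|x\|_X=\sup_i|x_i|<\infty$ (resp. $u\in\prod_i F_i$ with $\|u\|_U=\sup_i|u_i|<\infty$). For $x\in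 X$ write $\bar x_i=(x_j)_{j\in I_i}$, and for $u\in U$ put $f(x,u)=(f_i(x_i,\bar x_i,u_i))_{i\in\mathbb N}$. Let $\mathcal U$ be the set of $u\in L^\infty(\mathbb R_+,U)$ that are piecewise right-continuous (right-continuous at every $t\ge0$, with finitely many discontinuities in each bounded interval), with the essential supremum norm $\|u\|_{\mathcal U}$. For $x^0\in X$ and $u\in\mathcal U$, a *solution* of $\Sigma:\ \dot x=f(x,u)$, $x(0)=x^0$, is a function $\lambda:[0,T)\to X$, $0<T\le\infty$, such that $s\mapsto f(\lambda(s),u(s))$ is an $X$-valued, locally Bochner integrable function and $\lambda(t)=x^0+\int_0^tf(\lambda(s),u(s))\,ds$ for all $t\in[0,T)$; it is *maximal* if it cannot be extended to a solution on a larger interval $[0,T')$. Assume that $\Sigma$ is *well-posed*: for all $x^0\in X$, $u\in\mathcal U$ there is a unique maximal solution $\phi(\cdot,x^0,u)$, and every maximal solution that is bounded is defined on all of $\mathbb R_+$. **Subsystems.** Assume that there are continuous functions $V_i:E_i\to\mathbb R_+$, continuously differentiable on $E_i\setminus\{0\}$, functions $\psi_1,\psi_2\in\mathcal K_\infty$ and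 $\tilde\alpha\in\mathcal K$ independent of $i$, internal gains $\gamma_{ij}\in\mathcal K\cup\{0\}$ with $\gamma_{ij}=0$ for $j\notin I_i$, and external gains $\gamma_{iu}\in\mathcal K$ such that $\psi_1(|x_i|)\le V_i(x_i)\le\psi_2(|x_i|)$ for all $i$ and $x_i\in E_i$, and for all $x\in X$, $u\in U$, $i\in\mathbb N$ $$V_i(x_i)>\max\Bigl\{\sup_{j\in I_i}\gamma_{ij}(V_j(x_j)),\ \gamma_{iu}(|u_i|)\Bigr\}\ \Rightarrow\ \nabla V_i(x_i)\,f_i(x_i,\bar x_i,u_i)\le-\tilde\alpha(V_i(x_i)).$$ Assume that the family $\{\gamma_{ij}\}$ is pointwise equicontinuous and that there is $\gamma^u_{\max}\in\mathcal K$ with $\gamma_{iu}\le\gamma^u_{\max}$ for all $i$. **Path of strict decay.** Let $\ell_\infty^+$ be the set of bounded sequences in $\mathbb R_+$, and let $\Gamma(s)=(\sup_{j}\gamma_{ij}(s_j))_{i\in\mathbb N}$ for $s\in\ell_\infty^+$. Assume that $\sigma:\mathbb R_+\to\ell_\infty^+$ is a path of strict decay for $\Gamma$, that is: (i) there is $\rho\in\mathcal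 K_\infty$ with $\Gamma(\sigma(r))_i\le(\mathrm{id}+\rho)^{-1}(\sigma_i(r))$ for all $r\ge0$ and $i\in\mathbb N$; (ii) there are $\sigma_{\min},\sigma_{\max}\in\mathcal K_\infty$ with $\sigma_{\min}\le\sigma_i\le\sigma_{\max}$ for all $i$; (iii) $\sigma_i\in\mathcal K_\infty$ for all $i$; (iv) for every compact interval $K\subset(0,\infty)$ there are $0<c\le C<\infty$ with $c|r_1-r_2|\le|\sigma_i^{-1}(r_1)-\sigma_i^{-1}(r_2)|\le C|r_1-r_2|$ for all $r_1,r_2\in K$ and $i\in\mathbb N$. Assume finally that for each $R>0$ there is $L(R)>0$ with $|V_i(x_i)-V_i(y_i)|\le L(R)|x_i-y_i|$ for all $i$ and all $x_i,y_i\in E_i$ with $|x_i|,|y_i|<R$. **Conclusion.** (a) $\Sigma$ is input-to-state stable: every maximal solution exists on $\mathbb R_+$, and there are $\beta\in\mathcal{KL}$, $\gamma\in\mathcal K$ with $\|\phi(t,x,u)\|_X\le\beta(\|x\|_X,t)+\gamma(\|u\|_{\mathcal U})$ for all $x\in X$, $u\in\mathcal U$, $t\ge0$. (b) The function $V(x)=\sup_{i\in\mathbb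 N}\sigma_i^{-1}(V_i(x_i))$ is finite on $X$ and is an ISS Lyapunov function for $\Sigma$: it is continuous; there are $\bar\psi_1,\bar\psi_2\in\mathcal K_\infty$ with $\bar\psi_1(\|x\|_X)\le V(x)\le\bar\psi_2(\|x\|_X)$ for all $x\in X$; and there are $\chi\in\mathcal K$, $\alpha\in\mathcal P$ such that for all $x\in X$, $u\in\mathcal U$ $$V(x)>\chi(\|u\|_{\mathcal U})\ \Rightarrow\ \limsup_{t\to0^+}\frac{V(\phi(t,x,u))-V(x)}{t}\le-\alpha(V(x)).$$ (c) $V$ is locally Lipschitz on $X\setminus\{0\}$: for every $x_0\in X\setminus\{0\}$ there are $\delta,L>0$ with $|V(x_1)-V(x_2)|\le L\|x_1-x_2\|_X$ for all $x_1,x_2\in X$ with $\|x_1-x_0\|_X\le\delta$, $\|x_2-x_0\|_X\le\delta$. -/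

import Mathlib

open Set Filter MeasureTheory
open scoped NNReal ENNReal Topology

/-! ### Comparison functions -/

/-- Class `K`: continuous, strictly increasing, zero at zero. -/
structure ClassK (g : ℝ≥0 → ℝ≥0) : Prop where
  continuous : Continuous g
  strictMono : StrictMono g
  map_zero : g 0 = 0

/-- Class `K∞`: unbounded functions of class `K`. -/
structure ClassKInf (g : ℝ≥0 → ℝ≥0) : Prop extends ClassK g where
  unbounded : ¬ BddAbove (range g)

/-- Class `L`: continuous, strictly decreasing, tending to zero at infinity. -/
structure ClassL (g : ℝ≥0 → ℝ≥0) : Prop where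
  continuous : Continuous g
  strictAnti : StrictAnti g
  tendsto_zero : Tendsto g atTop (𝓝 0)

/-- Class `KL`. -/
structure ClassKL (β : ℝ≥0 → ℝ≥0 → ℝ≥0) : Prop where
  continuous : Continuous fun p : ℝ≥0 × ℝ≥0 => β p.1 p.2
  classK : ∀ t, ClassK fun r => β r t
  classL : ∀ r, 0 < r → ClassL (β r)

/-- Class `P`: continuous positive definite functions. -/
structure ClassP (α : ℝ≥0 → ℝ≥0) : Prop where
  continuous : Continuous α
  map_zero : α 0 = 0
  pos : ∀ r, 0 < r → 0 < α r

/-! ### Infinite networks -/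

/-- A countable family of control systems `ẋ_i = f_i(x_i, x̄_i, u_i)` with state spaces `E i` and
external input spaces `F i`; the internal input `x̄_i` collects the states `x_j` with `j` in the
finite neighbour set `I i`. -/
structure InfiniteNetwork (E F : ℕ → Type*)
    [∀ i, TopologicalSpace (E i)] [∀ i, TopologicalSpace (F i)] where
  I : ℕ → Finset ℕ
  notMem_I : ∀ i, i ∉ I i
  f : ∀ i, E i → ((j : I i) → E j) → F i → E i
  continuous_f : ∀ i, Continuous fun p : E i × ((j : I i) → E j) × F i => f i p.1 p.2.1 p.2.2

section Inputs

variable {U : Type*} [NormedAddCommGroup U]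

/-- Admissible inputs: essentially bounded functions on `[0, ∞)` which are piecewise
right-continuous, that is, right-continuous everywhere with finitely many discontinuities in each
bounded interval. Values at negative times are irrelevant. -/
structure IsAdmissibleInput (u : ℝ → U) : Prop where
  memLp : MemLp u ∞ (volume.restrict (Ici 0))
  rightContinuous : ∀ t, 0 ≤ t → ContinuousWithinAt u (Ici t) t
  finite_discontinuities :
    ∀ T : ℝ, {t ∈ Icc 0 T | ¬ ContinuousWithinAt u (Ici 0) t}.Finite

/-- The essential supremum norm of an input on `[0, ∞)`. -/
noncomputable def inputNorm (u : ℝ → U) : ℝ≥0 :=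
  (eLpNorm u ∞ (volume.restrict (Ici 0))).toNNReal

end Inputs

/-- The interval `[0, T)`, where `T` may be `⊤`. -/
def timeDomain (T : EReal) : Set ℝ := {t | 0 ≤ t ∧ (t : EReal) < T}

/-- The upper right-hand Dini derivative at zero, with values in the extended reals. -/
noncomputable def upperDiniZero (g : ℝ → ℝ) : EReal :=
  limsup (fun t : ℝ => (((g t - g 0) / t : ℝ) : EReal)) (𝓝[>] 0)

namespace InfiniteNetwork

variable {E F : ℕ → Type*}
  [∀ i, NormedAddCommGroup (E i)] [∀ i, NormedSpace ℝ (E i)] [∀ i, NormedAddCommGroup (F i)]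
  (N : InfiniteNetwork E F)

/-- The right-hand side of the interconnection, with values in the full product. The state space is
`lp E ∞`, with norm `sup_i ‖x_i‖`, and the space of input values is `lp F ∞`. -/
def rhs (x : lp E ∞) (u : lp F ∞) : ∀ i, E i :=
  fun i => N.f i (x i) (fun j => x j) (u i)

/-- `z` is a solution on `[0, T)` of `ẋ = f(x, u)`, `x(0) = x₀`: the function `s ↦ f(z(s), u(s))`
takes values in `lp E ∞`, is locally Bochner integrable, and `z` satisfies the integral equation. -/
def IsSolution (u : ℝ → lp F ∞) (x₀ : lp E ∞) (T : EReal) (z : ℝ → lp E ∞) : Prop :=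
  0 < T ∧ ∃ g : ℝ → lp E ∞,
    (∀ s ∈ timeDomain T, ∀ i, g s i = N.rhs (z s) (u s) i) ∧
    ∀ t ∈ timeDomain T, IntervalIntegrable g volume 0 t ∧ z t = x₀ + ∫ s in (0 : ℝ)..t, g s

/-- A solution which cannot be extended to a larger interval. -/
def IsMaximalSolution (u : ℝ → lp F ∞) (x₀ : lp E ∞) (T : EReal) (z : ℝ → lp E ∞) : Prop :=
  N.IsSolution u x₀ T z ∧
    ∀ T' z', N.IsSolution u x₀ T' z' → T ≤ T' → EqOn z z' (timeDomain T) → T' = T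

/-- Well-posedness: for all data there is a unique maximal solution, and maximal solutions that
are uniformly bounded exist for all times. -/
structure WellPosed : Prop where
  existsUnique : ∀ u, IsAdmissibleInput u → ∀ x₀, ∃ T z, N.IsMaximalSolution u x₀ T z ∧
    ∀ T' z', N.IsMaximalSolution u x₀ T' z' → T' = T ∧ EqOn z' z (timeDomain T)
  bounded_continuation : ∀ u, IsAdmissibleInput u → ∀ x₀ T z, N.IsMaximalSolution u x₀ T z →
    (∃ C : ℝ, ∀ t ∈ timeDomain T, ‖z t‖ ≤ C) → T = ⊤

/-- All maximal solutions exist on `[0, ∞)`. -/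
def ForwardComplete : Prop :=
  ∀ u, IsAdmissibleInput u → ∀ x₀ T z, N.IsMaximalSolution u x₀ T z → T = ⊤

/-- Input-to-state stability (of a well-posed network). -/
def IsISS : Prop :=
  N.ForwardComplete ∧ ∃ β γ, ClassKL β ∧ ClassK γ ∧
    ∀ u, IsAdmissibleInput u → ∀ x₀ T z, N.IsMaximalSolution u x₀ T z →
      ∀ t : ℝ≥0, ‖z t‖₊ ≤ β ‖x₀‖₊ t + γ (inputNorm u)

/-- ISS Lyapunov functions (of a well-posed network) in implication form: the Lie derivative along
the maximal solution for the data `(x₀, u)` is at most `-α (W x₀)` whenever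
`W x₀ > χ (inputNorm u)`. -/
def IsISSLyapunovFunction (W : lp E ∞ → ℝ≥0) : Prop :=
  Continuous W ∧
  (∃ ψ₁ ψ₂, ClassKInf ψ₁ ∧ ClassKInf ψ₂ ∧ ∀ x, ψ₁ ‖x‖₊ ≤ W x ∧ W x ≤ ψ₂ ‖x‖₊) ∧
  ∃ χ α, ClassK χ ∧ ClassP α ∧
    ∀ u, IsAdmissibleInput u → ∀ x₀ T z, N.IsMaximalSolution u x₀ T z →
      χ (inputNorm u) < W x₀ →
        upperDiniZero (fun t => (W (z t) : ℝ)) ≤ ((-(α (W x₀) : ℝ) : ℝ) : EReal)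

/-- The family `V i` consists of ISS Lyapunov functions for the subsystems, with internal gains
`γ i j`, external gains `γu i`, and with coercivity bounds `ψ₁`, `ψ₂` and decay rate `α` that do
not depend on `i`. -/
structure SubsystemLyapunov (V : ∀ i, E i → ℝ≥0) (ψ₁ ψ₂ : ℝ≥0 → ℝ≥0) (γ : ℕ → ℕ → ℝ≥0 → ℝ≥0)
    (γu : ℕ → ℝ≥0 → ℝ≥0) (α : ℝ≥0 → ℝ≥0) : Prop where
  continuous : ∀ i, Continuous (V i)
  contDiffOn : ∀ i, ContDiffOn ℝ 1 (fun x => (V i x : ℝ)) {0}ᶜ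
  classKInf_lower : ClassKInf ψ₁
  classKInf_upper : ClassKInf ψ₂
  coercive : ∀ i x, ψ₁ ‖x‖₊ ≤ V i x ∧ V i x ≤ ψ₂ ‖x‖₊
  gain_classK : ∀ i j, ClassK (γ i j) ∨ γ i j = 0
  gain_eq_zero : ∀ i j, j ∉ N.I i → γ i j = 0
  extGain_classK : ∀ i, ClassK (γu i)
  decay_classK : ClassK α
  decay : ∀ (x : lp E ∞) (u : lp F ∞) (i : ℕ),
    max ((N.I i).sup fun j => γ i j (V j (x j))) (γu i ‖u i‖₊) < V i (x i) →
      fderiv ℝ (fun y => (V i y : ℝ)) (x i) (N.rhs x u i) ≤ -(α (V i (x i)) : ℝ)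

end InfiniteNetwork

/-! ### Gain operator and paths of strict decay -/

/-- The gain operator `Γ(s) = (sup_j γ_ij(s_j))_i`. -/
noncomputable def gainOperator (γ : ℕ → ℕ → ℝ≥0 → ℝ≥0) (s : ℕ → ℝ≥0) : ℕ → ℝ≥0 :=
  fun i => ⨆ j, γ i j (s j)

/-- Paths of strict decay for the gain operator. The inverses are those of bijections of `ℝ≥0`. -/
structure IsPathOfStrictDecay (γ : ℕ → ℕ → ℝ≥0 → ℝ≥0) (σ : ℝ≥0 → ℕ → ℝ≥0) : Prop where
  bounded : ∀ r, BddAbove (range (σ r))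
  decay : ∃ ρ, ClassKInf ρ ∧
    ∀ r i, gainOperator γ (σ r) i ≤ Function.invFun (fun s => s + ρ s) (σ r i)
  bounds : ∃ σmin σmax, ClassKInf σmin ∧ ClassKInf σmax ∧ ∀ i r, σmin r ≤ σ r i ∧ σ r i ≤ σmax r
  classKInf : ∀ i, ClassKInf fun r => σ r i
  biLipschitz : ∀ a b : ℝ≥0, 0 < a → ∃ c C : ℝ, 0 < c ∧ c ≤ C ∧
    ∀ r₁ ∈ Icc a b, ∀ r₂ ∈ Icc a b, ∀ i,
      c * dist r₁ r₂ ≤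
        dist (Function.invFun (fun r => σ r i) r₁) (Function.invFun (fun r => σ r i) r₂) ∧
      dist (Function.invFun (fun r => σ r i) r₁) (Function.invFun (fun r => σ r i) r₂) ≤
        C * dist r₁ r₂

/-- The terms `σ_i⁻¹(V_i(x_i))`, `i ∈ ℕ`. -/
noncomputable def scaledLyapunov {E : ℕ → Type*} [∀ i, NormedAddCommGroup (E i)]
    (V : ∀ i, E i → ℝ≥0) (σ : ℝ≥0 → ℕ → ℝ≥0) (x : lp E ∞) (i : ℕ) : ℝ≥0 :=
  Function.invFun (fun r => σ r i) (V i (x i))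

/-- The composite function `V(x) = sup_i σ_i⁻¹(V_i(x_i))`. -/
noncomputable def networkLyapunov {E : ℕ → Type*} [∀ i, NormedAddCommGroup (E i)]
    (V : ∀ i, E i → ℝ≥0) (σ : ℝ≥0 → ℕ → ℝ≥0) (x : lp E ∞) : ℝ≥0 :=
  ⨆ i, scaledLyapunov V σ x i

/-! ### Inverses and compositions of comparison functions -/

/-! The value `v` of the supremum is governed by the components whose scaled value `σ_i⁻¹(V_i(x_i))`
is close to `v`, and these dominate their gains with a margin that does not depend on `i`. Indeed
`σ_i(v) - (id + ρ)⁻¹(σ_i(v))` is bounded below through `ρ` and `σmin`, while the bi-Lipschitz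
condition makes the `σ_i` uniformly Lipschitz on compact intervals. Hence there are `v₁ < v < v₂`
with `Γ(σ(v₂))_i < σ_i(v₁)` for all `i` (`exists_gainOperator_lt`): as long as the supremum stays
below `v₂`, every component above `v₁` exceeds its internal gains, and also its external gain if `v`
exceeds a gain of the input.

The difficulty is that infinitely many components decay and the supremum need not be attained. All
components are therefore compared with one descending line, on one time interval during which the
line stays above `v₁` and the supremum below `v₂`. A component touching the line is in the decaying
regime and cannot cross it, so the supremum stays below the line as well (`exists_local_decay`).

The resulting rates are locally uniform in `v` and are glued to one rate of class `P`
(`exists_classP_of_local`). This gives the Dini estimate at once. With a scalar comparison principle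
(`exists_classKL_comparison`) and the coercivity bounds it also gives the stability estimate, whose
boundedness yields forward completeness. Continuity and the local Lipschitz property come from
truncating the supremum below at a level `a > 0`, which keeps all arguments of `σ_i⁻¹` in a compact
subinterval of `(0, ∞)`. -/

theorem ClassK.pos {g : ℝ≥0 → ℝ≥0} (hg : ClassK g) {r : ℝ≥0} (hr : 0 < r) : 0 < g r := by
  simpa [hg.map_zero] using hg.strictMono hr

theorem ClassK.comp {g h : ℝ≥0 → ℝ≥0} (hg : ClassK g) (hh : ClassK h) :
    ClassK fun r => g (h r) where
  continuous := hg.continuous.comp hh.continuous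
  strictMono := hg.strictMono.comp hh.strictMono
  map_zero := by rw [hh.map_zero, hg.map_zero]

namespace ClassKInf

variable {g h : ℝ≥0 → ℝ≥0}

theorem surjective (hg : ClassKInf g) : Function.Surjective g := by
  intro y
  obtain ⟨_, ⟨x, rfl⟩, hx⟩ := not_bddAbove_iff.1 hg.unbounded y
  obtain ⟨z, -, hz⟩ := intermediate_value_Icc (zero_le (a := x)) hg.continuous.continuousOn
    ⟨by rw [hg.map_zero]; exact zero_le, hx.le⟩
  exact ⟨z, hz⟩

theorem apply_invFun (hg : ClassKInf g) (y : ℝ≥0) : g (Function.invFun g y) = y :=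
  Function.rightInverse_invFun hg.surjective y

theorem invFun_apply (hg : ClassKInf g) (x : ℝ≥0) : Function.invFun g (g x) = x :=
  Function.leftInverse_invFun hg.strictMono.injective x

theorem strictMono_invFun (hg : ClassKInf g) : StrictMono (Function.invFun g) := by
  intro a b hab
  rw [← hg.strictMono.lt_iff_lt, hg.apply_invFun, hg.apply_invFun]
  exact hab

theorem invFun (hg : ClassKInf g) : ClassKInf (Function.invFun g) where
  continuous := hg.strictMono_invFun.monotone.continuous_of_surjective
    fun x => ⟨g x, hg.invFun_apply x⟩
  strictMono := hg.strictMono_invFun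
  map_zero := by simpa [hg.map_zero] using hg.invFun_apply 0
  unbounded := by
    rw [Function.Surjective.range_eq fun x => ⟨g x, hg.invFun_apply x⟩]
    exact not_bddAbove_univ

theorem comp (hg : ClassKInf g) (hh : ClassKInf h) : ClassKInf fun r => g (h r) where
  toClassK := hg.toClassK.comp hh.toClassK
  unbounded := by
    rw [Function.Surjective.range_eq (f := fun r => g (h r)) (hg.surjective.comp hh.surjective)]
    exact not_bddAbove_univ

theorem id_add (hg : ClassKInf g) : ClassKInf fun r => r + g r where
  continuous := continuous_id.add hg.continuous
  strictMono := strictMono_id.add hg.strictMono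
  map_zero := by simp [hg.map_zero]
  unbounded := by
    rw [not_bddAbove_iff]
    exact fun y => ⟨_, ⟨y + 1, rfl⟩, (lt_add_one y).trans_le le_self_add⟩

theorem le_invFun_iff (hg : ClassKInf g) {x y : ℝ≥0} : x ≤ Function.invFun g y ↔ g x ≤ y := by
  rw [← hg.strictMono.le_iff_le, hg.apply_invFun]

theorem invFun_le_iff (hg : ClassKInf g) {x y : ℝ≥0} : Function.invFun g y ≤ x ↔ y ≤ g x := by
  rw [← hg.strictMono.le_iff_le, hg.apply_invFun]

theorem invFun_lt_iff (hg : ClassKInf g) {x y : ℝ≥0} : Function.invFun g y < x ↔ y < g x := by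
  rw [← hg.strictMono.lt_iff_lt, hg.apply_invFun]

end ClassKInf

theorem ClassKL.comp {β : ℝ≥0 → ℝ≥0 → ℝ≥0} {g h : ℝ≥0 → ℝ≥0} (hβ : ClassKL β) (hg : ClassK g)
    (hh : ClassK h) : ClassKL fun r t => g (β (h r) t) where
  continuous := hg.continuous.comp (hβ.continuous.comp
    ((hh.continuous.comp continuous_fst).prodMk continuous_snd))
  classK t := hg.comp ((hβ.classK t).comp hh)
  classL r hr :=
    { continuous := hg.continuous.comp (hβ.classL _ (hh.pos hr)).continuous
      strictAnti := hg.strictMono.comp_strictAnti (hβ.classL _ (hh.pos hr)).strictAnti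
      tendsto_zero := by
        have := (hg.continuous.tendsto 0).comp (hβ.classL _ (hh.pos hr)).tendsto_zero
        rwa [hg.map_zero] at this }

/-- A family of properties of rates which hold locally uniformly on `(0, ∞)` holds for a rate of
class `P`. -/
theorem exists_classP_of_local {P : ℝ≥0 → ℝ≥0 → Prop}
    (hP : ∀ r k k', 0 < k' → k' ≤ k → P r k → P r k')
    (hloc : ∀ r, 0 < r → ∃ k, 0 < k ∧ ∀ᶠ s in 𝓝 r, P s k) :
    ∃ α, ClassP α ∧ (∀ r, α r ≤ r) ∧ ∀ r, 0 < r → P r (α r) := by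
  -- The admissible rates at `r` form an interval, since a positive rate may be lowered. Being
  -- convex, these sets allow locally constant choices to be glued by a partition of unity.
  obtain ⟨g, hg⟩ := exists_continuous_forall_mem_convex_of_local_const (X := Ioi (0 : ℝ≥0))
    (E := ℝ) (t := fun r => {k | 0 < k ∧ P r k.toNNReal})
    (fun r => OrdConnected.convex ⟨fun a ha b hb x hx => ⟨ha.1.trans_le hx.1,
      hP _ _ _ (Real.toNNReal_pos.2 (ha.1.trans_le hx.1)) (Real.toNNReal_mono hx.2) hb.2⟩⟩)
    (fun r => by
      obtain ⟨k, hk, h⟩ := hloc r r.2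
      refine ⟨k, ?_⟩
      filter_upwards [continuous_subtype_val.continuousAt.eventually h] with s hs
      exact ⟨hk, by simpa using hs⟩)
  -- The minimum with `r` forces continuity at `0`, where `g` is not controlled.
  let α : ℝ≥0 → ℝ≥0 := fun r => if h : 0 < r then min (g ⟨r, h⟩).toNNReal r else 0
  have hle : ∀ r, α r ≤ r := fun r => by
    simp only [α]
    split_ifs
    exacts [min_le_right _ _, zero_le]
  have h0 : α 0 = 0 := by simp [α]
  have hpos : ∀ r, 0 < r → 0 < α r := fun r hr => by
    simp only [α, dif_pos hr]
    exact lt_min (Real.toNNReal_pos.2 (hg _).1) hr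
  refine ⟨α, ⟨continuous_iff_continuousAt.2 fun r => ?_, h0, hpos⟩, hle, fun r hr => ?_⟩
  · rcases eq_or_lt_of_le (zero_le (a := r)) with rfl | hr
    · rw [ContinuousAt, h0]
      exact tendsto_of_tendsto_of_tendsto_of_le_of_le tendsto_const_nhds
        (continuous_id.tendsto' 0 0 rfl) (fun _ => zero_le) hle
    · have : ContinuousOn α (Ioi 0) := by
        rw [continuousOn_iff_continuous_domRestrict]
        have : (Ioi 0).domRestrict α = fun r => min (g r).toNNReal (r : ℝ≥0) := by
          ext1 s
          exact dif_pos s.2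
        rw [this]
        fun_prop
      exact this.continuousAt (Ioi_mem_nhds hr)
  · refine hP _ _ _ (hpos r hr) ?_ (hg ⟨r, hr⟩).2
    simp only [α, dif_pos hr]
    exact min_le_left _ _

/-! ### The scalar comparison principle -/

/-- For a decay rate `α` with `α r ≤ r`, the rescaled time `H` along solutions of `ẏ = -α(y)` in
logarithmic coordinates. -/
theorem ClassP.exists_orderIso_hasDerivAt {α : ℝ≥0 → ℝ≥0} (hα : ClassP α) (hle : ∀ r, α r ≤ r) :
    ∃ H : ℝ ≃o ℝ, ∀ w, HasDerivAt H (Real.exp w / α (Real.exp w).toNNReal) w := by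
  set h : ℝ → ℝ := fun w => Real.exp w / α (Real.exp w).toNNReal with hh
  have hpos : ∀ w, 0 < (α (Real.exp w).toNNReal : ℝ) := fun w =>
    NNReal.coe_pos.2 (hα.pos _ (Real.toNNReal_pos.2 (Real.exp_pos w)))
  have hcont : Continuous h := by
    refine Real.continuous_exp.div ?_ fun w => (hpos w).ne'
    exact NNReal.continuous_coe.comp
      (hα.continuous.comp (continuous_real_toNNReal.comp Real.continuous_exp))
  -- For `w = log y` the equation `ẏ = -α(y)` reads `ẇ = -1 / h(w)`, so a primitive of `h` falls at
  -- unit speed. The bound `h ≥ 1` makes this primitive grow at least like the identity, hence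
  -- surjective.
  have hone : ∀ w, 1 ≤ h w := fun w => by
    rw [hh, one_le_div (hpos w)]
    have := NNReal.coe_le_coe.2 (hle (Real.exp w).toNNReal)
    rwa [Real.coe_toNNReal _ (Real.exp_pos w).le] at this
  set H : ℝ → ℝ := fun w => ∫ s in (0 : ℝ)..w, h s with hH
  have hd : ∀ w, HasDerivAt H (h w) w := fun w => (hcont.integral_hasStrictDerivAt 0 w).hasDerivAt
  have hmono : StrictMono H := strictMono_of_deriv_pos fun w => by
    rw [(hd w).deriv]
    exact one_pos.trans_le (hone w)
  have hd' : ∀ w, HasDerivAt (fun w => H w - w) (h w - 1) w := fun w =>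
    (hd w).sub (hasDerivAt_id' w)
  have hmono' : Monotone fun w => H w - w := by
    refine monotone_of_deriv_nonneg (fun w => (hd' w).differentiableAt) fun w => ?_
    rw [(hd' w).deriv]
    exact sub_nonneg.2 (hone w)
  have hH0 : H 0 = 0 := by simp [hH]
  have hsurj : Function.Surjective H := by
    refine Continuous.surjective (continuous_iff_continuousAt.2 fun w => (hd w).continuousAt)
      (tendsto_atTop_mono' _ ?_ tendsto_id) (tendsto_atBot_mono' _ ?_ tendsto_id)
    · filter_upwards [eventually_ge_atTop 0] with w hw
      have := hmono' hw
      simp only [hH0] at this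
      simp only [id]
      linarith
    · filter_upwards [eventually_le_atBot 0] with w hw
      have := hmono' hw
      simp only [hH0] at this
      simp only [id]
      linarith
  exact ⟨hmono.orderIsoOfSurjective H hsurj, hd⟩

/-- The solution at time `t` of a scalar equation with initial value `r`, for which
`H ∘ log` decreases at unit speed. -/
noncomputable def scalarFlow (H : ℝ ≃o ℝ) (r t : ℝ≥0) : ℝ≥0 :=
  if r = 0 then 0 else (Real.exp (H.symm (H (Real.log r) - t))).toNNReal

theorem coe_scalarFlow (H : ℝ ≃o ℝ) {r : ℝ≥0} (hr : 0 < r) (t : ℝ≥0) :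
    (scalarFlow H r t : ℝ) = Real.exp (H.symm (H (Real.log r) - t)) := by
  rw [scalarFlow, if_neg hr.ne', Real.coe_toNNReal _ (Real.exp_pos _).le]

theorem scalarFlow_zero_left (H : ℝ ≃o ℝ) (t : ℝ≥0) : scalarFlow H 0 t = 0 := by
  simp [scalarFlow]

theorem scalarFlow_pos (H : ℝ ≃o ℝ) {r : ℝ≥0} (hr : 0 < r) (t : ℝ≥0) : 0 < scalarFlow H r t := by
  rw [← NNReal.coe_pos, coe_scalarFlow H hr]
  exact Real.exp_pos _

theorem scalarFlow_le (H : ℝ ≃o ℝ) (r t : ℝ≥0) : scalarFlow H r t ≤ r := by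
  rcases eq_zero_or_pos r with rfl | hr
  · rw [scalarFlow_zero_left]
  · rw [← NNReal.coe_le_coe, coe_scalarFlow H hr, ← Real.le_log_iff_exp_le (NNReal.coe_pos.2 hr),
      OrderIso.symm_apply_le]
    exact sub_le_self _ t.2

/-- Away from `r = 0` everything follows from `H` being an order isomorphism of the whole line: the
logarithm tends to `-∞` without reaching it in finite time. At `r = 0`, continuity is a squeeze by
`scalarFlow_le`. -/
theorem classKL_scalarFlow (H : ℝ ≃o ℝ) : ClassKL (scalarFlow H) := by
  have hc : Continuous fun p : ℝ≥0 × ℝ≥0 => scalarFlow H p.1 p.2 := by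
    refine continuous_iff_continuousAt.2 fun ⟨r, t⟩ => ?_
    rcases eq_zero_or_pos r with rfl | hr
    · rw [ContinuousAt, scalarFlow_zero_left]
      exact tendsto_of_tendsto_of_tendsto_of_le_of_le tendsto_const_nhds
        (continuous_fst.tendsto' _ 0 rfl) (fun _ => zero_le) fun p => scalarFlow_le H p.1 p.2
    · have hev : (fun p : ℝ≥0 × ℝ≥0 => (Real.exp (H.symm (H (Real.log p.1) - p.2))).toNNReal)
          =ᶠ[𝓝 (r, t)] fun p => scalarFlow H p.1 p.2 := by
        filter_upwards [continuous_fst.continuousAt.eventually (Ioi_mem_nhds hr)] with p hp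
        rw [scalarFlow, if_neg (ne_of_gt hp)]
      refine ContinuousAt.congr ?_ hev
      refine continuous_real_toNNReal.continuousAt.comp (Real.continuous_exp.continuousAt.comp
        (H.symm.continuous.continuousAt.comp (ContinuousAt.sub
          (H.continuous.continuousAt.comp ?_) (by fun_prop))))
      exact ContinuousAt.log (by fun_prop) (NNReal.coe_pos.2 hr).ne'
  refine ⟨hc, fun t => ⟨hc.comp (continuous_id.prodMk continuous_const), ?_,
    scalarFlow_zero_left H t⟩,
    fun r hr => ⟨hc.comp (continuous_const.prodMk continuous_id), ?_, ?_⟩⟩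
  · intro r s hrs
    rcases eq_zero_or_pos r with rfl | hr
    · simpa [scalarFlow_zero_left] using scalarFlow_pos H hrs t
    · have := Real.log_lt_log (NNReal.coe_pos.2 hr) (NNReal.coe_lt_coe.2 hrs)
      rw [← NNReal.coe_lt_coe, coe_scalarFlow H hr, coe_scalarFlow H (hr.trans hrs)]
      exact Real.exp_lt_exp.2 (H.symm.strictMono (sub_lt_sub_right (H.strictMono this) _))
  · intro s t hst
    rw [← NNReal.coe_lt_coe, coe_scalarFlow H hr, coe_scalarFlow H hr]
    exact Real.exp_lt_exp.2 (H.symm.strictMono (sub_lt_sub_left (NNReal.coe_lt_coe.2 hst) _))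
  · rw [← NNReal.tendsto_coe]
    simp only [coe_scalarFlow H hr]
    refine Real.tendsto_exp_atBot.comp (H.symm.tendsto_atBot.comp ?_)
    simp only [sub_eq_add_neg]
    exact tendsto_atBot_add_const_left _ _ (tendsto_neg_atTop_atBot.comp
      (NNReal.tendsto_coe_atTop.2 tendsto_id))

/-- A barrier which is not crossed at any contact point is an upper bound. -/
theorem image_le_of_eventually_le_of_eq {f B : ℝ → ℝ} {a b : ℝ} (hf : ContinuousOn f (Icc a b))
    (hB : ContinuousOn B (Icc a b)) (ha : f a ≤ B a)
    (h : ∀ t ∈ Ico a b, f t = B t → ∀ᶠ s in 𝓝[>] t, f s ≤ B s) :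
    ∀ t ∈ Icc a b, f t ≤ B t := by
  have hclosed : IsClosed ({t | f t ≤ B t} ∩ Icc a b) := by
    have := isClosed_Icc.isClosed_le hf hB
    convert this using 1
    ext t
    simp [and_comm]
  refine hclosed.Icc_subset_of_forall_mem_nhdsWithin ha fun t ht => ?_
  rcases (show f t ≤ B t from ht.1).eq_or_lt with heq | hlt
  · exact h t ht.2 heq
  · have hmem : t ∈ Icc a b := Ico_subset_Icc_self ht.2
    have hev := (hf t hmem).eventually_lt (hB t hmem) hlt
    have hle : 𝓝[>] t ≤ 𝓝[Icc a b] t := by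
      rw [← nhdsWithin_Ioo_eq_nhdsGT ht.2.2]
      exact nhdsWithin_mono _ fun s hs => ⟨ht.2.1.trans hs.1.le, hs.2.le⟩
    filter_upwards [hle hev] with s hs using hs.le

/-- A continuous function which does not increase to the right of any point where it exceeds `c`
stays below `c` once it is there. -/
theorem le_of_eventually_le_of_lt {y : ℝ → ℝ} {a b c : ℝ} (hab : a ≤ b)
    (hy : ContinuousOn y (Icc a b))
    (hdec : ∀ t ∈ Ico a b, c < y t → ∀ᶠ s in 𝓝[>] t, y s ≤ y t)
    (ha : y a ≤ c) : y b ≤ c := by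
  -- The barriers are constants `d > c`, because at the level `c` itself `hdec` says nothing.
  refine le_of_forall_gt_imp_ge_of_dense fun d hd => ?_
  refine image_le_of_eventually_le_of_eq hy continuousOn_const (ha.trans hd.le)
    (fun t ht heq => ?_) b (right_mem_Icc.2 hab)
  simpa only [heq] using hdec t ht (heq ▸ hd)

/-- A scalar comparison principle: there is a bound of class `KL` for functions whose decay rate is
at least `α` while they exceed a threshold. -/
theorem ClassP.exists_classKL_comparison {α : ℝ≥0 → ℝ≥0} (hα : ClassP α) (hle : ∀ r, α r ≤ r) :
    ∃ β, ClassKL β ∧ ∀ (y : ℝ → ℝ≥0) (c b : ℝ≥0), ContinuousOn y (Icc 0 b) →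
      (∀ t ∈ Ico (0 : ℝ) b, c < y t →
        ∀ᶠ s in 𝓝[>] t, (y s : ℝ) ≤ y t - α (y t) * (s - t)) →
      y b ≤ max (β (y 0) b) c := by
  obtain ⟨H, hH⟩ := hα.exists_orderIso_hasDerivAt hle
  refine ⟨scalarFlow H, classKL_scalarFlow H, fun y c b hy hdec => ?_⟩
  have hyR : ContinuousOn (fun t => (y t : ℝ)) (Icc 0 b) :=
    NNReal.continuous_coe.comp_continuousOn hy
  rw [le_max_iff]
  by_contra! hcon
  obtain ⟨hflow, hcb⟩ := hcon
  -- Once at or below `c`, the function stays there; since `y b` exceeds `c`, the decay is in force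
  -- on all of `[0, b]`.
  have hgt : ∀ t ∈ Icc (0 : ℝ) b, c < y t := by
    intro t ht
    by_contra! hle
    refine hcb.not_ge (NNReal.coe_le_coe.1 (le_of_eventually_le_of_lt ht.2
      (hyR.mono (Icc_subset_Icc_left ht.1)) (fun s hs hlt => ?_) (NNReal.coe_le_coe.2 hle)))
    filter_upwards [hdec s ⟨ht.1.trans hs.1, hs.2⟩ (NNReal.coe_lt_coe.1 hlt),
      self_mem_nhdsWithin] with r hr hsr
    have := mul_nonneg (α (y s)).2 (sub_nonneg.2 (le_of_lt hsr))
    simp only [NNReal.val_eq_coe] at this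
    linarith
  have hpos : ∀ t ∈ Icc (0 : ℝ) b, (0 : ℝ) < y t := fun t ht =>
    NNReal.coe_pos.2 (zero_le.trans_lt (hgt t ht))
  have h0 : (0 : ℝ) ∈ Icc (0 : ℝ) b := left_mem_Icc.2 b.2
  have hb : (b : ℝ) ∈ Icc (0 : ℝ) b := right_mem_Icc.2 b.2
  have key : H (Real.log (y b)) ≤ H (Real.log (y 0)) - b := by
    refine image_le_of_liminf_slope_right_le_deriv_boundary
      (f := fun t => H (Real.log (y t))) (B := fun t => H (Real.log (y 0)) - t)
      (B' := fun _ => -1)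
      (H.continuous.comp_continuousOn (hyR.log fun t ht => (hpos t ht).ne'))
      (by simp) (by fun_prop)
      (fun t _ => ((hasDerivAt_id' t).const_sub _).hasDerivWithinAt) (fun t ht r hr => ?_) hb
    have ht' := Ico_subset_Icc_self ht
    -- In the coordinate `H ∘ log` the line bounding `y` to the right of `t` has slope exactly `-1`
    -- at `t`. By monotonicity this bounds the right slopes of `H ∘ log ∘ y`, without any
    -- differentiability of `y`.
    have hderiv : HasDerivAt (fun s => H (Real.log (y t - α (y t) * (s - t)))) (-1) t := by
      have h1 : HasDerivAt (fun s => (y t : ℝ) - α (y t) * (s - t)) (-(α (y t) : ℝ)) t := by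
        simpa using (((hasDerivAt_id' t).sub_const t).const_mul (α (y t) : ℝ)).const_sub (y t : ℝ)
      have h2 := h1.log (by simpa using (hpos t ht').ne')
      simp only [sub_self, mul_zero, sub_zero] at h2
      have h3 := (hH (Real.log (y t)))
      rw [Real.exp_log (hpos t ht'), Real.toNNReal_coe] at h3
      have h4 := HasDerivAt.comp_of_eq t h3 h2 (by simp)
      have hα0 : (α (y t) : ℝ) ≠ 0 :=
        (NNReal.coe_pos.2 (hα.pos _ (NNReal.coe_pos.1 (hpos t ht')))).ne'
      have heq : (y t : ℝ) / α (y t) * (-α (y t) / y t) = -1 := by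
        have := (hpos t ht').ne'
        field_simp
      rw [heq] at h4
      exact h4
    have hslope := ((hasDerivWithinAt_iff_tendsto_slope' self_notMem_Ioi).1
      (hderiv.hasDerivWithinAt (s := Ioi t))).eventually (gt_mem_nhds hr)
    refine Eventually.frequently ?_
    filter_upwards [hslope, hdec t ht (hgt t ht'), Ioo_mem_nhdsGT ht.2] with s hs hys hst
    refine lt_of_le_of_lt ?_ hs
    rw [slope_def_field, slope_def_field]
    refine div_le_div_of_nonneg_right ?_ (sub_nonneg.2 hst.1.le)
    simp only [sub_self, mul_zero, sub_zero]
    refine sub_le_sub_right (H.monotone (Real.log_le_log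
      (hpos s ⟨ht.1.trans hst.1.le, hst.2.le⟩) hys)) _
  refine hflow.not_ge ?_
  rw [← NNReal.coe_le_coe, coe_scalarFlow H (NNReal.coe_pos.1 (hpos 0 h0)),
    ← Real.log_le_iff_le_exp (hpos b hb), OrderIso.le_symm_apply]
  exact key

/-! ### The composite Lyapunov function -/

section Composite

variable {E : ℕ → Type*} [∀ i, NormedAddCommGroup (E i)]
  {V : ∀ i, E i → ℝ≥0} {ψ₁ ψ₂ σmin σmax : ℝ≥0 → ℝ≥0} {σ : ℝ≥0 → ℕ → ℝ≥0}

theorem nnnorm_lp_apply_le (x : lp E ∞) (i : ℕ) : ‖x i‖₊ ≤ ‖x‖₊ :=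
  lp.norm_apply_le_norm ENNReal.top_ne_zero x i

theorem apply_scaledLyapunov (hσ : ∀ i, ClassKInf fun r => σ r i) (x : lp E ∞) (i : ℕ) :
    σ (scaledLyapunov V σ x i) i = V i (x i) :=
  (hσ i).apply_invFun _

theorem scaledLyapunov_le (hσ : ∀ i, ClassKInf fun r => σ r i) (hmin : ClassKInf σmin)
    (hle : ∀ i r, σmin r ≤ σ r i) (hψ₂ : ClassKInf ψ₂) (hV : ∀ i x, V i x ≤ ψ₂ ‖x‖₊)
    (x : lp E ∞) (i : ℕ) :
    scaledLyapunov V σ x i ≤ Function.invFun σmin (ψ₂ ‖x‖₊) := by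
  rw [hmin.le_invFun_iff]
  refine (hle i _).trans ?_
  rw [apply_scaledLyapunov hσ]
  exact (hV i _).trans (hψ₂.strictMono.monotone (nnnorm_lp_apply_le x i))

theorem bddAbove_range_scaledLyapunov (hσ : ∀ i, ClassKInf fun r => σ r i)
    (hmin : ClassKInf σmin) (hle : ∀ i r, σmin r ≤ σ r i) (hψ₂ : ClassKInf ψ₂)
    (hV : ∀ i x, V i x ≤ ψ₂ ‖x‖₊) (x : lp E ∞) : BddAbove (range (scaledLyapunov V σ x)) :=
  ⟨_, forall_mem_range.2 (scaledLyapunov_le hσ hmin hle hψ₂ hV x)⟩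

theorem networkLyapunov_le (hσ : ∀ i, ClassKInf fun r => σ r i) (hmin : ClassKInf σmin)
    (hle : ∀ i r, σmin r ≤ σ r i) (hψ₂ : ClassKInf ψ₂) (hV : ∀ i x, V i x ≤ ψ₂ ‖x‖₊)
    (x : lp E ∞) : networkLyapunov V σ x ≤ Function.invFun σmin (ψ₂ ‖x‖₊) :=
  ciSup_le (scaledLyapunov_le hσ hmin hle hψ₂ hV x)

/-- The norm need not be attained by a component, so the inequality is inverted into an upper bound
for every `‖x i‖`, and the least upper bound property applies. -/
theorem le_networkLyapunov (hσ : ∀ i, ClassKInf fun r => σ r i) (hmax : ClassKInf σmax)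
    (hle : ∀ i r, σ r i ≤ σmax r) (hψ₁ : ClassKInf ψ₁) (hV : ∀ i x, ψ₁ ‖x‖₊ ≤ V i x)
    (x : lp E ∞) (hx : BddAbove (range (scaledLyapunov V σ x))) :
    Function.invFun σmax (ψ₁ ‖x‖₊) ≤ networkLyapunov V σ x := by
  rw [hmax.invFun_le_iff, ← hψ₁.le_invFun_iff, ← NNReal.coe_le_coe]
  refine (lp.isLUB_norm x).2 (forall_mem_range.2 fun i => ?_)
  change ((‖x i‖₊ : ℝ≥0) : ℝ) ≤ _
  rw [NNReal.coe_le_coe, hψ₁.le_invFun_iff]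
  refine (hV i _).trans ?_
  rw [← apply_scaledLyapunov (V := V) hσ]
  exact (hle i _).trans (hmax.strictMono.monotone (le_ciSup hx i))

/-- Truncated from below by a positive constant, the composite function is Lipschitz on balls. -/
theorem dist_max_networkLyapunov_le {γ : ℕ → ℕ → ℝ≥0 → ℝ≥0} (hσ : IsPathOfStrictDecay γ σ)
    (hψ₂ : ClassKInf ψ₂) (hV : ∀ i x, V i x ≤ ψ₂ ‖x‖₊)
    (hLip : ∀ R : ℝ, 0 < R → ∃ L : ℝ, 0 < L ∧ ∀ i, ∀ x ∈ Metric.ball (0 : E i) R,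
      ∀ y ∈ Metric.ball (0 : E i) R, dist (V i x) (V i y) ≤ L * ‖x - y‖)
    {a : ℝ≥0} (ha : 0 < a) {R : ℝ} (hR : 0 < R) :
    ∃ L : ℝ, 0 < L ∧ ∀ x ∈ Metric.ball (0 : lp E ∞) R, ∀ y ∈ Metric.ball (0 : lp E ∞) R,
      dist (max (networkLyapunov V σ x) a) (max (networkLyapunov V σ y) a) ≤ L * ‖x - y‖ := by
  obtain ⟨σmin, σmax, hmin, hmax, hb⟩ := hσ.bounds
  have hbdd := bddAbove_range_scaledLyapunov hσ.classKInf hmin (fun i r => (hb i r).1) hψ₂ hV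
  obtain ⟨L, hL, hVL⟩ := hLip R hR
  obtain ⟨c, C, hc, hcC, hC⟩ := hσ.biLipschitz (σmin a) (max (ψ₂ R.toNNReal) (σmax a)) (hmin.pos ha)
  have hC0 : 0 < C := hc.trans_le hcC
  refine ⟨C * L, mul_pos hC0 hL, ?_⟩
  -- By monotonicity of `σ_i⁻¹`, truncating at `a` outside is truncating at `σ_i(a)` inside. This
  -- puts the argument of `σ_i⁻¹` in an interval independent of `i` and bounded away from `0`.
  have hterm : ∀ x ∈ Metric.ball (0 : lp E ∞) R, ∀ i, max (scaledLyapunov V σ x i) a =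
      Function.invFun (fun r => σ r i) (max (V i (x i)) (σ a i)) ∧
      max (V i (x i)) (σ a i) ∈ Icc (σmin a) (max (ψ₂ R.toNNReal) (σmax a)) := by
    intro x hx i
    constructor
    · rw [(hσ.classKInf i).strictMono_invFun.monotone.map_max]
      rw [(hσ.classKInf i).invFun_apply a]
      rfl
    · refine ⟨(hb i a).1.trans (le_max_right _ _), max_le_max ((hV i _).trans
        (hψ₂.strictMono.monotone ((nnnorm_lp_apply_le x i).trans ?_))) (hb i a).2⟩
      rw [mem_ball_zero_iff] at hx
      exact NNReal.le_toNNReal_of_coe_le hx.le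
  have hone : ∀ x ∈ Metric.ball (0 : lp E ∞) R, ∀ y ∈ Metric.ball (0 : lp E ∞) R,
      ((max (networkLyapunov V σ x) a : ℝ≥0) : ℝ) ≤
        (max (networkLyapunov V σ y) a : ℝ≥0) + C * L * ‖x - y‖ := by
    intro x hx y hy
    have hnn : 0 ≤ C * L * ‖x - y‖ := by positivity
    have hi : ∀ i, (scaledLyapunov V σ x i : ℝ) ≤
        (max (networkLyapunov V σ y) a : ℝ≥0) + C * L * ‖x - y‖ := by
      intro i
      have hball : ∀ z ∈ Metric.ball (0 : lp E ∞) R, z i ∈ Metric.ball (0 : E i) R := by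
        intro z hz
        rw [mem_ball_zero_iff] at hz ⊢
        exact (lp.norm_apply_le_norm ENNReal.top_ne_zero z i).trans_lt hz
      obtain ⟨hx1, hx2⟩ := hterm x hx i
      obtain ⟨hy1, hy2⟩ := hterm y hy i
      have h1 := (hC _ hx2 _ hy2 i).2
      rw [← hx1, ← hy1] at h1
      have h2 : dist (max (V i (x i)) (σ a i)) (max (V i (y i)) (σ a i)) ≤
          dist (V i (x i)) (V i (y i)) := by
        simpa only [NNReal.dist_eq, NNReal.coe_max] using abs_max_sub_max_le_abs _ _ _
      have h3 := hVL i _ (hball x hx) _ (hball y hy)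
      have h4 : ‖x i - y i‖ ≤ ‖x - y‖ := nnnorm_lp_apply_le (x - y) i
      have h5 : ((max (scaledLyapunov V σ x i) a : ℝ≥0) : ℝ) -
          (max (scaledLyapunov V σ y i) a : ℝ≥0) ≤
          C * L * ‖x - y‖ := by
        have := (le_abs_self _).trans_eq (NNReal.dist_eq (max (scaledLyapunov V σ x i) a)
          (max (scaledLyapunov V σ y i) a)).symm
        refine this.trans (h1.trans ?_)
        rw [mul_assoc]
        exact mul_le_mul_of_nonneg_left (h2.trans (h3.trans
          (mul_le_mul_of_nonneg_left h4 hL.le))) hC0.le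
      have h6 : max (scaledLyapunov V σ y i) a ≤ max (networkLyapunov V σ y) a :=
        max_le_max_right _ (le_ciSup (hbdd y) i)
      have h7 := NNReal.coe_le_coe.2 (le_max_left (scaledLyapunov V σ x i) a)
      have h8 := NNReal.coe_le_coe.2 h6
      linarith
    rw [NNReal.coe_max]
    refine max_le ?_ ?_
    · have : networkLyapunov V σ x ≤
          ((max (networkLyapunov V σ y) a : ℝ≥0) + C * L * ‖x - y‖ : ℝ).toNNReal :=
        ciSup_le fun i => NNReal.le_toNNReal_of_coe_le (hi i)
      exact (Real.le_toNNReal_iff_coe_le (by positivity)).1 this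
    · have := NNReal.coe_le_coe.2 (le_max_right (networkLyapunov V σ y) a)
      linarith
  intro x hx y hy
  have h1 := hone x hx y hy
  have h2 := hone y hy x hx
  rw [norm_sub_rev] at h2
  rw [NNReal.dist_eq, abs_sub_le_iff]
  constructor <;> linarith

variable {γ : ℕ → ℕ → ℝ≥0 → ℝ≥0}

theorem networkLyapunov_pos (hσ : IsPathOfStrictDecay γ σ) (hψ₁ : ClassKInf ψ₁)
    (hψ₂ : ClassKInf ψ₂) (hV : ∀ i x, ψ₁ ‖x‖₊ ≤ V i x ∧ V i x ≤ ψ₂ ‖x‖₊) {x : lp E ∞}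
    (hx : x ≠ 0) : 0 < networkLyapunov V σ x := by
  obtain ⟨σmin, σmax, hmin, hmax, hb⟩ := hσ.bounds
  exact (hmax.invFun.pos (hψ₁.pos (nnnorm_pos.2 hx))).trans_le
    (le_networkLyapunov hσ.classKInf hmax (fun i r => (hb i r).2) hψ₁ (fun i x => (hV i x).1) x
      (bddAbove_range_scaledLyapunov hσ.classKInf hmin (fun i r => (hb i r).1) hψ₂
        (fun i x => (hV i x).2) x))

/-- The composite function is continuous. -/
theorem continuous_networkLyapunov (hσ : IsPathOfStrictDecay γ σ)
    (hψ₂ : ClassKInf ψ₂) (hV : ∀ i x, V i x ≤ ψ₂ ‖x‖₊)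
    (hLip : ∀ R : ℝ, 0 < R → ∃ L : ℝ, 0 < L ∧ ∀ i, ∀ x ∈ Metric.ball (0 : E i) R,
      ∀ y ∈ Metric.ball (0 : E i) R, dist (V i x) (V i y) ≤ L * ‖x - y‖) :
    Continuous (networkLyapunov V σ) := by
  have hmax : ∀ a : ℝ≥0, 0 < a → Continuous fun x : lp E ∞ => max (networkLyapunov V σ x) a := by
    intro a ha
    refine continuous_iff_continuousAt.2 fun x => ?_
    have hR : 0 < ‖x‖ + 1 := by positivity
    obtain ⟨L, hL, h⟩ := dist_max_networkLyapunov_le hσ hψ₂ hV hLip ha hR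
    have hx : Metric.ball (0 : lp E ∞) (‖x‖ + 1) ∈ 𝓝 x :=
      Metric.isOpen_ball.mem_nhds (by simp)
    refine ContinuousOn.continuousAt (s := Metric.ball (0 : lp E ∞) (‖x‖ + 1)) ?_ hx
    exact (LipschitzOnWith.of_dist_le_mul (K := L.toNNReal) fun y hy z hz => by
      rw [Real.coe_toNNReal _ hL.le, dist_eq_norm y z]
      exact h y hy z hz).continuousOn
  -- Truncation at `ε / 2` changes the function by at most `ε / 2` everywhere, so it is a uniform
  -- limit of continuous functions; this covers the origin, where no bi-Lipschitz constants are
  -- available.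
  refine continuous_of_uniform_approx_of_continuous fun u hu => ?_
  obtain ⟨ε, hε, hεu⟩ := Metric.mem_uniformity_dist.1 hu
  refine ⟨_, hmax (ε / 2).toNNReal (Real.toNNReal_pos.2 (half_pos hε)), fun x => hεu ?_⟩
  rw [NNReal.dist_eq, NNReal.coe_max, Real.coe_toNNReal _ (half_pos hε).le, abs_lt]
  have := (networkLyapunov V σ x).2
  simp only [NNReal.val_eq_coe] at this
  rcases max_cases (networkLyapunov V σ x : ℝ) (ε / 2) with h | h <;> constructor <;> linarith

/-- The composite function is locally Lipschitz away from the origin. -/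
theorem exists_dist_networkLyapunov_le (hσ : IsPathOfStrictDecay γ σ) (hψ₁ : ClassKInf ψ₁)
    (hψ₂ : ClassKInf ψ₂) (hV : ∀ i x, ψ₁ ‖x‖₊ ≤ V i x ∧ V i x ≤ ψ₂ ‖x‖₊)
    (hLip : ∀ R : ℝ, 0 < R → ∃ L : ℝ, 0 < L ∧ ∀ i, ∀ x ∈ Metric.ball (0 : E i) R,
      ∀ y ∈ Metric.ball (0 : E i) R, dist (V i x) (V i y) ≤ L * ‖x - y‖)
    {x₀ : lp E ∞} (hx₀ : x₀ ≠ 0) : ∃ δ L : ℝ, 0 < δ ∧ 0 < L ∧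
      ∀ x₁ ∈ Metric.closedBall x₀ δ, ∀ x₂ ∈ Metric.closedBall x₀ δ,
        dist (networkLyapunov V σ x₁) (networkLyapunov V σ x₂) ≤ L * ‖x₁ - x₂‖ := by
  obtain ⟨a, ha0, ha⟩ := exists_between (networkLyapunov_pos hσ hψ₁ hψ₂ hV hx₀)
  have hcont := continuous_networkLyapunov hσ hψ₂ (fun i x => (hV i x).2) hLip
  have hR : 0 < ‖x₀‖ + 1 := by positivity
  obtain ⟨L, hL, h⟩ := dist_max_networkLyapunov_le hσ hψ₂ (fun i x => (hV i x).2) hLip ha0 hR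
  -- Near `x₀` the function exceeds `a`, so the truncation is inactive there.
  obtain ⟨δ, hδ, hball⟩ := Metric.nhds_basis_closedBall.mem_iff.1 (inter_mem
    (hcont.continuousAt.eventually (Ioi_mem_nhds ha))
    (Metric.isOpen_ball.mem_nhds (show x₀ ∈ Metric.ball 0 (‖x₀‖ + 1) by simp)))
  refine ⟨δ, L, hδ, hL, fun x₁ h₁ x₂ h₂ => ?_⟩
  have := h x₁ (hball h₁).2 x₂ (hball h₂).2
  rwa [max_eq_left (le_of_lt (hball h₁).1), max_eq_left (le_of_lt (hball h₂).1)] at this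

end Composite

/-! ### Inputs and solutions -/

/-- Right-continuity spreads a violation at `t` over some `[t, b)`, a set of positive measure. The
pointwise bound is needed because the decay condition of the subsystems involves the value `u t`. -/
theorem IsAdmissibleInput.nnnorm_le_inputNorm {U : Type*} [NormedAddCommGroup U] {u : ℝ → U}
    (hu : IsAdmissibleInput u) {t : ℝ} (ht : 0 ≤ t) : ‖u t‖₊ ≤ inputNorm u := by
  by_contra! hlt
  have hev : ∀ᶠ s in 𝓝[≥] t, inputNorm u < ‖u s‖₊ :=
    (hu.rightContinuous t ht).nnnorm.eventually (lt_mem_nhds hlt)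
  obtain ⟨b, hb, hsub⟩ := mem_nhdsGE_iff_exists_Ico_subset.1 hev
  have hae : ∀ᵐ s ∂volume.restrict (Ici (0 : ℝ)), ‖u s‖₊ ≤ inputNorm u := by
    filter_upwards [enorm_ae_le_eLpNormEssSup u (volume.restrict (Ici (0 : ℝ)))] with s hs
    rw [inputNorm, ← ENNReal.coe_le_coe, ENNReal.coe_toNNReal hu.memLp.2.ne, eLpNorm_exponent_top]
    exact hs
  rw [ae_restrict_iff' measurableSet_Ici, ae_iff] at hae
  have hpos : volume (Ico t b) ≠ 0 := by
    rw [Real.volume_Ico]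
    exact (ENNReal.ofReal_pos.2 (sub_pos.2 hb)).ne'
  refine hpos (measure_mono_null (fun s hs => ?_) hae)
  simp only [mem_ofPred_eq, not_forall]
  exact ⟨ht.trans hs.1, not_le.2 (hsub hs)⟩

theorem zero_mem_timeDomain {T : EReal} (hT : 0 < T) : (0 : ℝ) ∈ timeDomain T :=
  ⟨le_rfl, by simpa using hT⟩

theorem Icc_subset_timeDomain {T : EReal} {b : ℝ} (hb : b ∈ timeDomain T) :
    Icc 0 b ⊆ timeDomain T := fun _ hs =>
  ⟨hs.1, (EReal.coe_le_coe_iff.2 hs.2).trans_lt hb.2⟩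

theorem exists_gt_mem_timeDomain {T : EReal} {t : ℝ} (ht : t ∈ timeDomain T) :
    ∃ b, t < b ∧ b ∈ timeDomain T := by
  obtain ⟨b, htb, hbT⟩ := EReal.lt_iff_exists_real_btwn.1 ht.2
  have htb' := EReal.coe_lt_coe_iff.1 htb
  exact ⟨b, htb', ht.1.trans htb'.le, hbT⟩

namespace InfiniteNetwork

variable {E F : ℕ → Type*}
  [∀ i, NormedAddCommGroup (E i)] [∀ i, NormedSpace ℝ (E i)] [∀ i, NormedAddCommGroup (F i)]
  {N : InfiniteNetwork E F} {u : ℝ → lp F ∞} {x₀ : lp E ∞} {T : EReal} {z : ℝ → lp E ∞}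

namespace IsSolution

theorem apply_zero (hz : N.IsSolution u x₀ T z) : z 0 = x₀ := by
  obtain ⟨hT, g, -, hint⟩ := hz
  simpa using (hint 0 (zero_mem_timeDomain hT)).2

theorem continuousOn (hz : N.IsSolution u x₀ T z) {b : ℝ} (hb : b ∈ timeDomain T) :
    ContinuousOn z (Icc 0 b) := by
  obtain ⟨hT, g, -, hint⟩ := hz
  have h := intervalIntegral.continuousOn_primitive_interval' (hint b hb).1 left_mem_uIcc
  rw [uIcc_of_le hb.1] at h
  exact (continuousOn_const.add h).congr fun s hs => (hint s (Icc_subset_timeDomain hb hs)).2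

theorem continuousWithinAt_Ici (hz : N.IsSolution u x₀ T z) {t : ℝ} (ht : t ∈ timeDomain T) :
    ContinuousWithinAt z (Ici t) t := by
  obtain ⟨b, htb, hb⟩ := exists_gt_mem_timeDomain ht
  refine ((hz.continuousOn hb) t ⟨ht.1, htb.le⟩).mono_of_mem_nhdsWithin ?_
  exact mem_of_superset (Icc_mem_nhdsGE htb) (Icc_subset_Icc_left ht.1)

/-- Every component of a solution has a right derivative, given by the right-hand side. -/
theorem hasDerivWithinAt [∀ i, FiniteDimensional ℝ (E i)] (hz : N.IsSolution u x₀ T z)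
    (hu : IsAdmissibleInput u) {t : ℝ} (ht : t ∈ timeDomain T) (i : ℕ) :
    HasDerivWithinAt (fun s => z s i) (N.rhs (z t) (u t) i) (Ici t) t := by
  have hzc := hz.continuousWithinAt_Ici ht
  obtain ⟨hT, g, hg, hint⟩ := hz
  obtain ⟨b, htb, hb⟩ := exists_gt_mem_timeDomain ht
  have (j : ℕ) : CompleteSpace (E j) := FiniteDimensional.complete ℝ (E j)
  let e : lp E ∞ →L[ℝ] E i := lp.evalCLM ℝ E ∞ i
  have hmem : ∀ᶠ s in 𝓝[≥] t, s ∈ timeDomain T := by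
    filter_upwards [Icc_mem_nhdsGE htb] with s hs
    exact Icc_subset_timeDomain hb ⟨ht.1.trans hs.1, hs.2⟩
  -- A component of the right-hand side involves finitely many coordinates, so it is
  -- right-continuous in time; no continuity of the full right-hand side in the supremum norm is
  -- assumed. Hence right derivatives are taken componentwise.
  have hrhs : ContinuousWithinAt (fun s => N.rhs (z s) (u s) i) (Ici t) t := by
    have hEc (j : ℕ) : ContinuousWithinAt (fun s => z s j) (Ici t) t :=
      (lp.lipschitzWith_one_eval ∞ j).continuous.continuousAt.comp_continuousWithinAt hzc
    have hFc : ContinuousWithinAt (fun s => u s i) (Ici t) t :=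
      (lp.lipschitzWith_one_eval ∞ i).continuous.continuousAt.comp_continuousWithinAt
        (hu.rightContinuous t ht.1)
    have hI : ContinuousWithinAt (fun s (j : N.I i) => z s j) (Ici t) t :=
      continuousWithinAt_pi.2 fun j => hEc j
    exact (N.continuous_f i).continuousAt.comp_continuousWithinAt
      ((hEc i).prodMk (hI.prodMk hFc))
  have hgc : ContinuousWithinAt (fun s => e (g s)) (Ici t) t :=
    hrhs.congr_of_eventuallyEq (hmem.mono fun s hs => hg s hs i) (hg t ht i)
  have hgint : ∀ s ∈ timeDomain T, IntervalIntegrable (fun s => e (g s)) volume 0 s := fun s hs =>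
    ⟨e.integrable_comp (hint s hs).1.1, e.integrable_comp (hint s hs).1.2⟩
  have hmeas : StronglyMeasurableAtFilter (fun s => e (g s)) (𝓝[>] t) := by
    refine ⟨Ioc 0 b, ?_, (hgint b hb).1.aestronglyMeasurable⟩
    filter_upwards [Ioo_mem_nhdsGT htb] with s hs
    exact ⟨ht.1.trans_lt hs.1, hs.2.le⟩
  have hd := (intervalIntegral.integral_hasDerivWithinAt_right (s := Ici t) (t := Ioi t)
    (hgint t ht) hmeas (hgc.mono Ioi_subset_Ici_self)).const_add (x₀ i)
  have heq : ∀ s ∈ timeDomain T, z s i = x₀ i + ∫ r in (0 : ℝ)..s, e (g r) := fun s hs => by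
    rw [e.intervalIntegral_comp_comm (hint s hs).1, (hint s hs).2]
    rfl
  have hd' := hd.congr_of_eventuallyEq (hmem.mono heq) (heq t ht)
  rw [← hg t ht i]
  exact hd'

end IsSolution

/-- Along a solution, a component of the composite Lyapunov function decreases as soon as it
exceeds its gains. -/
theorem IsSolution.eventually_scaledLyapunov_le [∀ i, FiniteDimensional ℝ (E i)]
    {V : ∀ i, E i → ℝ≥0} {ψ₁ ψ₂ : ℝ≥0 → ℝ≥0} {γ : ℕ → ℕ → ℝ≥0 → ℝ≥0} {γu : ℕ → ℝ≥0 → ℝ≥0}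
    {α : ℝ≥0 → ℝ≥0} (hV : N.SubsystemLyapunov V ψ₁ ψ₂ γ γu α) {σ : ℝ≥0 → ℕ → ℝ≥0}
    (hσ : ∀ i, ClassKInf fun r => σ r i) (hz : N.IsSolution u x₀ T z) (hu : IsAdmissibleInput u)
    {t : ℝ} (ht : t ∈ timeDomain T) {i : ℕ} {a b : ℝ≥0} {c k : ℝ} (hc : 0 < c) (hk : 0 ≤ k)
    (hbiLip : ∀ r₁ ∈ Icc a b, ∀ r₂ ∈ Icc a b, c * dist r₁ r₂ ≤
      dist (Function.invFun (fun r => σ r i) r₁) (Function.invFun (fun r => σ r i) r₂))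
    (hab : V i (z t i) ∈ Ioo a b) (hkα : k < α (V i (z t i)))
    (hgain : max ((N.I i).sup fun j => γ i j (V j (z t j))) (γu i ‖u t i‖₊) < V i (z t i)) :
    ∀ᶠ s in 𝓝[>] t, (scaledLyapunov V σ (z s) i : ℝ) ≤
      scaledLyapunov V σ (z t) i - c * k * (s - t) := by
  -- `V i` is differentiable only off the origin, which `V i (z t i) > a` excludes.
  have hne : z t i ≠ 0 := by
    intro h0
    have h1 := (hV.coercive i (z t i)).2
    rw [h0, nnnorm_zero, hV.classKInf_upper.map_zero] at h1
    have h2 := zero_le.trans_lt hab.1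
    rw [h0] at h2
    exact h1.not_gt h2
  have hdiff : DifferentiableAt ℝ (fun y => (V i y : ℝ)) (z t i) :=
    ((hV.contDiffOn i).contDiffAt (isOpen_compl_singleton.mem_nhds hne)).differentiableAt
      one_ne_zero
  have hd : HasDerivWithinAt (fun s => (V i (z s i) : ℝ))
      (fderiv ℝ (fun y => (V i y : ℝ)) (z t i) (N.rhs (z t) (u t) i)) (Ici t) t :=
    HasFDerivAt.comp_hasDerivWithinAt (f := fun s => z s i) t hdiff.hasFDerivAt
      (hz.hasDerivWithinAt hu ht i)
  have hlt : fderiv ℝ (fun y => (V i y : ℝ)) (z t i) (N.rhs (z t) (u t) i) < -k :=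
    (hV.decay (z t) (u t) i hgain).trans_lt (neg_lt_neg hkα)
  have hslope := ((hasDerivWithinAt_iff_tendsto_slope' self_notMem_Ioi).1
    (hd.mono Ioi_subset_Ici_self)).eventually (gt_mem_nhds hlt)
  have hcont : ContinuousWithinAt (fun s => V i (z s i)) (Ioi t) t := by
    refine (hV.continuous i).continuousAt.comp_continuousWithinAt ?_
    exact (hz.hasDerivWithinAt hu ht i).continuousWithinAt.mono Ioi_subset_Ici_self
  filter_upwards [hslope, hcont.eventually (Ioo_mem_nhds hab.1 hab.2), self_mem_nhdsWithin]
    with s hs hsab hst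
  have hst' : 0 < s - t := sub_pos.2 hst
  rw [slope_def_field, div_lt_iff₀ hst'] at hs
  have hle : V i (z s i) ≤ V i (z t i) := by
    rw [← NNReal.coe_le_coe]
    nlinarith [mul_nonneg hk hst'.le]
  have hle' : scaledLyapunov V σ (z s) i ≤ scaledLyapunov V σ (z t) i :=
    (hσ i).strictMono_invFun.monotone hle
  -- The lower bi-Lipschitz constant `c` turns a decrease of `V i` into a decrease of `σ_i⁻¹(V_i)`
  -- at least `c` times as large.
  have h := hbiLip _ (Ioo_subset_Icc_self hab) _ (Ioo_subset_Icc_self hsab)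
  rw [NNReal.dist_eq, NNReal.dist_eq, abs_of_nonneg (sub_nonneg.2 (NNReal.coe_le_coe.2 hle))] at h
  have h' := abs_of_nonneg (sub_nonneg.2 (NNReal.coe_le_coe.2 hle'))
  rw [scaledLyapunov, scaledLyapunov] at h'
  rw [h'] at h
  rw [scaledLyapunov, scaledLyapunov]
  have h2 : c * (k * (s - t)) ≤ c * (V i (z t i) - V i (z s i)) :=
    mul_le_mul_of_nonneg_left (by linarith) hc.le
  linarith

end InfiniteNetwork

/-! ### Decay of the composite function along solutions -/

/-- Along a path of strict decay, the gain operator stays below the path uniformly, even if the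
argument of the path is slightly increased on one side and decreased on the other. -/
theorem IsPathOfStrictDecay.exists_gainOperator_lt {γ : ℕ → ℕ → ℝ≥0 → ℝ≥0} {σ : ℝ≥0 → ℕ → ℝ≥0}
    (hσ : IsPathOfStrictDecay γ σ) {v w : ℝ≥0} (hw : w < v) :
    ∃ v₁ v₂, w < v₁ ∧ v₁ < v ∧ v < v₂ ∧ ∀ i, gainOperator γ (σ v₂) i < σ v₁ i := by
  obtain ⟨σmin, σmax, hmin, hmax, hb⟩ := hσ.bounds
  obtain ⟨ρ, hρ, hdecay⟩ := hσ.decay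
  have hv : 0 < v := zero_le.trans_lt hw
  have hv2 : 0 < v / 2 := half_pos hv
  set q := Function.invFun fun s => s + ρ s
  have hqK : ClassKInf q := hρ.id_add.invFun
  -- Since `s - q s = ρ (q s)`, this bounds the gap between `σ_i(v₂)` and `(id + ρ)⁻¹(σ_i(v₂))` from
  -- below, uniformly in `i`.
  set d : ℝ≥0 := ρ (q (σmin v))
  have hdpos : 0 < d := hρ.pos (hqK.pos (hmin.pos hv))
  obtain ⟨c, C, hc, -, hbi⟩ := hσ.biLipschitz (σmin (v / 2)) (σmax (2 * v)) (hmin.pos hv2)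
  -- With `v₁` and `v₂` within `η` of `v`, one has `v₂ - v₁ < c * d`; as `σ_i` is Lipschitz with
  -- constant `1 / c`, it varies by less than `d` between them.
  have hη : 0 < (c * d / 2).toNNReal := Real.toNNReal_pos.2 (by positivity)
  set η := (c * d / 2).toNNReal
  have hηc : (η : ℝ) = c * d / 2 := Real.coe_toNNReal _ (by positivity)
  obtain ⟨v₁, h₁, hv₁⟩ := exists_between (max_lt (max_lt hw (half_lt_self hv))
    (tsub_lt_self hv hη))
  obtain ⟨v₂, hv₂, h₂⟩ := exists_between (lt_min (show v < 2 * v by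
    rw [two_mul]; exact lt_add_of_pos_right v hv) (lt_add_of_pos_right v hη))
  simp only [max_lt_iff] at h₁
  simp only [lt_min_iff] at h₂
  refine ⟨v₁, v₂, h₁.1.1, hv₁, hv₂, fun i => (hdecay v₂ i).trans_lt ?_⟩
  have hmono := (hσ.classKInf i).strictMono
  have hmem : ∀ s, v₁ ≤ s → s ≤ v₂ → σ s i ∈ Icc (σmin (v / 2)) (σmax (2 * v)) := fun s h h' =>
    ⟨(hmin.strictMono.monotone (h₁.1.2.le.trans h)).trans (hb i s).1,
      (hb i s).2.trans (hmax.strictMono.monotone (h'.trans h₂.1.le))⟩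
  have h12 := hv₁.trans hv₂
  have h3 := (hbi _ (hmem v₂ h12.le le_rfl) _ (hmem v₁ le_rfl h12.le) i).1
  rw [(hσ.classKInf i).invFun_apply v₂, (hσ.classKInf i).invFun_apply v₁, NNReal.dist_eq,
    NNReal.dist_eq, abs_of_pos (sub_pos.2 (NNReal.coe_lt_coe.2 h12)),
    abs_of_pos (sub_pos.2 (NNReal.coe_lt_coe.2 (hmono h12)))] at h3
  have h4 : (v₂ : ℝ) < v + η := by exact_mod_cast h₂.2
  have h5 : (v : ℝ) < v₁ + η := by exact_mod_cast lt_add_of_tsub_lt_right h₁.2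
  have h6 : (σ v₂ i : ℝ) - σ v₁ i < d := by
    refine lt_of_mul_lt_mul_left (h3.trans_lt ?_) hc.le
    linarith
  have h7 : q (σ v₂ i) + ρ (q (σ v₂ i)) = σ v₂ i := hρ.id_add.apply_invFun _
  have h8 : d ≤ ρ (q (σ v₂ i)) := hρ.strictMono.monotone (hqK.strictMono.monotone
    ((hmin.strictMono.monotone hv₂.le).trans (hb i v₂).1))
  rw [← NNReal.coe_lt_coe]
  have h9 : (q (σ v₂ i) : ℝ) + ρ (q (σ v₂ i)) = σ v₂ i := by exact_mod_cast h7
  have h10 := NNReal.coe_le_coe.2 h8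
  linarith

namespace InfiniteNetwork

variable {E F : ℕ → Type*}
  [∀ i, NormedAddCommGroup (E i)] [∀ i, NormedSpace ℝ (E i)] [∀ i, NormedAddCommGroup (F i)]
  {N : InfiniteNetwork E F} {V : ∀ i, E i → ℝ≥0} {ψ₁ ψ₂ : ℝ≥0 → ℝ≥0} {γ : ℕ → ℕ → ℝ≥0 → ℝ≥0}
  {γu : ℕ → ℝ≥0 → ℝ≥0} {α : ℝ≥0 → ℝ≥0} {σ : ℝ≥0 → ℕ → ℝ≥0}

theorem SubsystemLyapunov.bddAbove (hV : N.SubsystemLyapunov V ψ₁ ψ₂ γ γu α)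
    (hσ : IsPathOfStrictDecay γ σ) (x : lp E ∞) : BddAbove (range (scaledLyapunov V σ x)) := by
  obtain ⟨σmin, σmax, hmin, hmax, hb⟩ := hσ.bounds
  exact bddAbove_range_scaledLyapunov hσ.classKInf hmin (fun i r => (hb i r).1)
    hV.classKInf_upper (fun i x => (hV.coercive i x).2) x

/-- A component of the composite Lyapunov function which is close to the supremum exceeds its
internal gains. -/
theorem SubsystemLyapunov.sup_gain_lt (hV : N.SubsystemLyapunov V ψ₁ ψ₂ γ γu α)
    (hσ : IsPathOfStrictDecay γ σ) {x : lp E ∞} {i : ℕ} {v₁ v₂ : ℝ≥0}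
    (hgain : gainOperator γ (σ v₂) i < σ v₁ i) (h₁ : v₁ ≤ scaledLyapunov V σ x i)
    (h₂ : networkLyapunov V σ x ≤ v₂) :
    ((N.I i).sup fun j => γ i j (V j (x j))) < V i (x i) := by
  have hmono : ∀ j, Monotone (γ i j) := fun j => by
    rcases hV.gain_classK i j with h | h
    · exact h.strictMono.monotone
    · rw [h]
      exact monotone_const
  -- The supremum over all `j` would default to `0` if unbounded; only the finitely many neighbours
  -- contribute.
  have hbdd : BddAbove (range fun j => γ i j (σ v₂ j)) := by
    refine ⟨(N.I i).sup fun j => γ i j (σ v₂ j), forall_mem_range.2 fun j => ?_⟩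
    by_cases hj : j ∈ N.I i
    · exact Finset.le_sup (f := fun j => γ i j (σ v₂ j)) hj
    · simp [hV.gain_eq_zero i j hj]
  have hsup : ((N.I i).sup fun j => γ i j (V j (x j))) ≤ gainOperator γ (σ v₂) i := by
    refine Finset.sup_le fun j _ => le_trans ?_ (le_ciSup hbdd j)
    refine hmono j ?_
    rw [← apply_scaledLyapunov (V := V) hσ.classKInf]
    exact (hσ.classKInf j).strictMono.monotone ((le_ciSup (hV.bddAbove hσ x) j).trans h₂)
  refine hsup.trans_lt (hgain.trans_le ?_)
  rw [← apply_scaledLyapunov (V := V) hσ.classKInf]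
  exact (hσ.classKInf i).strictMono.monotone h₁

/-- The composite Lyapunov function decays along solutions at a rate which is locally uniform in
its value. -/
theorem SubsystemLyapunov.exists_local_decay [∀ i, FiniteDimensional ℝ (E i)]
    (hV : N.SubsystemLyapunov V ψ₁ ψ₂ γ γu α) (hσ : IsPathOfStrictDecay γ σ)
    (hcont : Continuous (networkLyapunov V σ)) {γmax σmin σmax : ℝ≥0 → ℝ≥0} (hγmax : ClassK γmax)
    (hγu : ∀ i r, γu i r ≤ γmax r) (hmin : ClassKInf σmin) (hmax : ClassKInf σmax)
    (hb : ∀ i r, σmin r ≤ σ r i ∧ σ r i ≤ σmax r) {v₀ : ℝ≥0} (hv₀ : 0 < v₀) :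
    ∃ κ : ℝ≥0, 0 < κ ∧ ∀ᶠ v in 𝓝 v₀, ∀ u, IsAdmissibleInput u → ∀ x₀ T z, N.IsSolution u x₀ T z →
      ∀ t ∈ timeDomain T, networkLyapunov V σ (z t) = v → γmax (inputNorm u) < σmin v →
        ∀ᶠ s in 𝓝[>] t, (networkLyapunov V σ (z s) : ℝ) ≤ v - κ * (s - t) := by
  have hv2 : 0 < v₀ / 2 := half_pos hv₀
  set a := σmin (v₀ / 2)
  set b := σmax (2 * v₀)
  have ha0 : 0 < a := hmin.pos hv2
  obtain ⟨c, C, hc, -, hbi⟩ := hσ.biLipschitz a b ha0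
  have hα0 : 0 < α a := hV.decay_classK.pos ha0
  set k : ℝ := (α a : ℝ)
  have hk0 : 0 < k := NNReal.coe_pos.2 hα0
  have hck : 0 < c * k := mul_pos hc hk0
  refine ⟨(c * k).toNNReal, Real.toNNReal_pos.2 hck, ?_⟩
  have hlt2 : v₀ < 2 * v₀ := by rw [two_mul]; exact lt_add_of_pos_right v₀ hv₀
  filter_upwards [Ioo_mem_nhds (half_lt_self hv₀) hlt2] with v hv u hu x₀ T z hz t ht hvt hχ
  rw [Real.coe_toNNReal _ hck.le]
  -- The lower bound imposed on `v₁` makes `σmin v₁` exceed both `a` and the external gain of the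
  -- input.
  obtain ⟨v₁, v₂, hw₁, hv₁, hv₂, hgain⟩ := hσ.exists_gainOperator_lt
    (max_lt hv.1 (hmin.invFun_lt_iff.2 hχ))
  rw [max_lt_iff, hmin.invFun_lt_iff] at hw₁
  have hVz : ContinuousWithinAt (fun s => networkLyapunov V σ (z s)) (Ici t) t :=
    hcont.continuousAt.comp_continuousWithinAt (hz.continuousWithinAt_Ici ht)
  obtain ⟨b₀, htb₀, hb₀⟩ := exists_gt_mem_timeDomain ht
  have hev : ∀ᶠ s in 𝓝[≥] t, s ∈ timeDomain T ∧ networkLyapunov V σ (z s) < v₂ ∧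
      (v₁ : ℝ) < v - c * k * (s - t) := by
    refine .and ?_ (.and ?_ ?_)
    · filter_upwards [Icc_mem_nhdsGE htb₀] with s hs
      exact Icc_subset_timeDomain hb₀ ⟨ht.1.trans hs.1, hs.2⟩
    · exact hVz.eventually (gt_mem_nhds (by simpa only [hvt] using hv₂))
    · have : ContinuousWithinAt (fun s : ℝ => (v : ℝ) - c * k * (s - t)) (Ici t) t := by fun_prop
      exact this.eventually (lt_mem_nhds (by simpa using hv₁))
  obtain ⟨t', htt', hsub⟩ := (mem_nhdsGE_iff_exists_Icc_subset (a := t)).1 hev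
  -- The time `t'` does not depend on `i`, which allows the supremum to be taken at the end. Contact
  -- with the line means a scaled value above `v₁`, where both gains are dominated.
  have hcomp : ∀ i, ∀ s ∈ Icc t t', (scaledLyapunov V σ (z s) i : ℝ) ≤ v - c * k * (s - t) := by
    intro i
    refine image_le_of_eventually_le_of_eq ?_ (by fun_prop) ?_ fun s hs heq => ?_
    · have hzc : ContinuousOn z (Icc t t') := (hz.continuousOn
        (hsub (right_mem_Icc.2 (le_of_lt htt'))).1).mono (Icc_subset_Icc_left ht.1)
      have hzi : ContinuousOn (fun s => z s i) (Icc t t') :=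
        (lp.lipschitzWith_one_eval ∞ i).continuous.comp_continuousOn hzc
      exact NNReal.continuous_coe.comp_continuousOn
        ((hσ.classKInf i).invFun.continuous.comp_continuousOn
          ((hV.continuous i).comp_continuousOn hzi))
    · have := le_ciSup (hV.bddAbove hσ (z t)) i
      rw [sub_self, mul_zero, sub_zero, NNReal.coe_le_coe, ← hvt]
      exact this
    · obtain ⟨hsT, hs₂, hs₁⟩ := hsub (Ico_subset_Icc_self hs)
      rw [← heq, NNReal.coe_lt_coe] at hs₁
      have hsv : scaledLyapunov V σ (z s) i ≤ v := by
        rw [← NNReal.coe_le_coe, heq]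
        exact sub_le_self _ (mul_nonneg hck.le (sub_nonneg.2 hs.1))
      have hVi := apply_scaledLyapunov (V := V) hσ.classKInf (z s) i
      have hσ₁ : σmin v₁ < V i (z s i) :=
        hVi ▸ (hb i v₁).1.trans_lt ((hσ.classKInf i).strictMono hs₁)
      have hσ₂ : V i (z s i) < b :=
        hVi ▸ (hb i _).2.trans_lt (hmax.strictMono (hsv.trans_lt hv.2))
      have haV : a < V i (z s i) := (hmin.strictMono hw₁.1).trans hσ₁
      have hu' : γu i ‖u s i‖₊ < V i (z s i) := by
        refine (hγu i _).trans_lt (lt_of_le_of_lt (hγmax.strictMono.monotone ?_)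
          (hw₁.2.trans hσ₁))
        exact (nnnorm_lp_apply_le (u s) i).trans (hu.nnnorm_le_inputNorm hsT.1)
      filter_upwards [hz.eventually_scaledLyapunov_le hV hσ.classKInf hu hsT hc hk0.le
        (fun r₁ h₁ r₂ h₂ => (hbi r₁ h₁ r₂ h₂ i).1) ⟨haV, hσ₂⟩
        (NNReal.coe_lt_coe.2 (hV.decay_classK.strictMono haV))
        (max_lt (hV.sup_gain_lt hσ (hgain i) hs₁.le hs₂.le) hu')] with r hr
      rw [heq] at hr
      linarith
  filter_upwards [Ioo_mem_nhdsGT htt'] with s hs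
  have hs' := Ioo_subset_Icc_self hs
  have hnn : 0 ≤ (v : ℝ) - c * k * (s - t) := v₁.2.trans (hsub hs').2.2.le
  refine (Real.le_toNNReal_iff_coe_le hnn).1 (ciSup_le fun i => ?_)
  exact NNReal.le_toNNReal_of_coe_le (hcomp i s hs')

/-- The composite Lyapunov function decays along solutions at a rate of class `P`. -/
theorem SubsystemLyapunov.exists_decay [∀ i, FiniteDimensional ℝ (E i)]
    (hV : N.SubsystemLyapunov V ψ₁ ψ₂ γ γu α) (hσ : IsPathOfStrictDecay γ σ)
    (hcont : Continuous (networkLyapunov V σ))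
    (hγu : ∃ γmax, ClassK γmax ∧ ∀ i r, γu i r ≤ γmax r) :
    ∃ χ κ, ClassK χ ∧ ClassP κ ∧ (∀ r, κ r ≤ r) ∧
      ∀ u, IsAdmissibleInput u → ∀ x₀ T z, N.IsSolution u x₀ T z → ∀ t ∈ timeDomain T,
        χ (inputNorm u) < networkLyapunov V σ (z t) → ∀ᶠ s in 𝓝[>] t,
          (networkLyapunov V σ (z s) : ℝ) ≤
            networkLyapunov V σ (z t) - κ (networkLyapunov V σ (z t)) * (s - t) := by
  obtain ⟨σmin, σmax, hmin, hmax, hb⟩ := hσ.bounds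
  obtain ⟨γmax, hγmax, hγu⟩ := hγu
  obtain ⟨κ, hκ, hκle, hdec⟩ := exists_classP_of_local (P := fun v κ =>
    ∀ u, IsAdmissibleInput u → ∀ x₀ T z, N.IsSolution u x₀ T z →
      ∀ t ∈ timeDomain T, networkLyapunov V σ (z t) = v → γmax (inputNorm u) < σmin v →
        ∀ᶠ s in 𝓝[>] t, (networkLyapunov V σ (z s) : ℝ) ≤ v - κ * (s - t))
    (fun v k k' _ hle h u hu x₀ T z hz t ht hvt hχ => by
      filter_upwards [h u hu x₀ T z hz t ht hvt hχ, self_mem_nhdsWithin] with s hs hst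
      refine hs.trans (sub_le_sub_left (mul_le_mul_of_nonneg_right (NNReal.coe_le_coe.2 hle)
        (sub_nonneg.2 (le_of_lt hst))) _))
    (fun v hv => hV.exists_local_decay hσ hcont hγmax hγu hmin hmax hb hv)
  refine ⟨fun r => Function.invFun σmin (γmax r), κ, hmin.invFun.toClassK.comp hγmax, hκ, hκle,
    fun u hu x₀ T z hz t ht hχ => ?_⟩
  exact hdec _ (zero_le.trans_lt hχ) u hu x₀ T z hz t ht rfl (hmin.invFun_lt_iff.1 hχ)

/-! ### From decay to input-to-state stability -/

/-- A well-posed network is input-to-state stable if some coercive continuous function decays along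
solutions while it exceeds a gain of the input. -/
theorem WellPosed.isISS_of_decay (hN : N.WellPosed) {W : lp E ∞ → ℝ≥0} (hW : Continuous W)
    {φ₁ φ₂ χ κ : ℝ≥0 → ℝ≥0} (hφ₁ : ClassKInf φ₁) (hφ₂ : ClassKInf φ₂)
    (hφW : ∀ x, φ₁ ‖x‖₊ ≤ W x ∧ W x ≤ φ₂ ‖x‖₊) (hχ : ClassK χ) (hκ : ClassP κ)
    (hκle : ∀ r, κ r ≤ r)
    (hdec : ∀ u, IsAdmissibleInput u → ∀ x₀ T z, N.IsSolution u x₀ T z → ∀ t ∈ timeDomain T,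
      χ (inputNorm u) < W (z t) → ∀ᶠ s in 𝓝[>] t, (W (z s) : ℝ) ≤ W (z t) - κ (W (z t)) * (s - t)) :
    N.IsISS := by
  obtain ⟨β, hβ, hcomp⟩ := hκ.exists_classKL_comparison hκle
  have key : ∀ u, IsAdmissibleInput u → ∀ x₀ T z, N.IsSolution u x₀ T z → ∀ t : ℝ≥0,
      (t : ℝ) ∈ timeDomain T → ‖z t‖₊ ≤ Function.invFun φ₁ (β (φ₂ ‖x₀‖₊) t) +
        Function.invFun φ₁ (χ (inputNorm u)) := by
    intro u hu x₀ T z hz t ht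
    have h := hcomp (fun s => W (z s)) (χ (inputNorm u)) t
      (hW.comp_continuousOn (hz.continuousOn ht)) fun s hs =>
        hdec u hu x₀ T z hz s (Icc_subset_timeDomain ht (Ico_subset_Icc_self hs))
    simp only [hz.apply_zero] at h
    have h' : φ₁ ‖z t‖₊ ≤ max (β (φ₂ ‖x₀‖₊) t) (χ (inputNorm u)) :=
      (hφW _).1.trans (h.trans (max_le_max_right _ ((hβ.classK t).strictMono.monotone (hφW x₀).2)))
    rw [← hφ₁.le_invFun_iff, hφ₁.strictMono_invFun.monotone.map_max] at h'
    exact h'.trans (max_le le_self_add le_add_self)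
  -- This makes the estimate uniform in time, as bounded continuation requires; `r = 0` is separate
  -- because class `L` is required only for `r > 0`.
  have hanti : ∀ r t, β r t ≤ β r 0 := fun r t => by
    rcases eq_zero_or_pos r with rfl | hr
    · rw [(hβ.classK t).map_zero]
      exact zero_le
    · exact (hβ.classL r hr).strictAnti.antitone zero_le
  have hcomplete : N.ForwardComplete := fun u hu x₀ T z hz =>
    hN.bounded_continuation u hu x₀ T z hz
      ⟨(Function.invFun φ₁ (β (φ₂ ‖x₀‖₊) 0) + Function.invFun φ₁ (χ (inputNorm u)) : ℝ≥0),
        fun t ht => NNReal.coe_le_coe.2 ((key u hu x₀ T z hz.1 ⟨t, ht.1⟩ ht).trans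
          (add_le_add_left (hφ₁.strictMono_invFun.monotone (hanti _ _)) _))⟩
  refine ⟨hcomplete, _, _, hβ.comp hφ₁.invFun.toClassK hφ₂.toClassK, hφ₁.invFun.toClassK.comp hχ,
    fun u hu x₀ T z hz t => key u hu x₀ T z hz.1 t ?_⟩
  rw [hcomplete u hu x₀ T z hz]
  exact ⟨t.2, EReal.coe_lt_top _⟩

end InfiniteNetwork

theorem upperDiniZero_le_of_eventually {g : ℝ → ℝ} {k : ℝ}
    (h : ∀ᶠ t in 𝓝[>] 0, g t ≤ g 0 - k * t) : upperDiniZero g ≤ ((-k : ℝ) : EReal) := by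
  refine limsup_le_of_le (h := ?_)
  filter_upwards [h, self_mem_nhdsWithin] with t ht htpos
  rw [EReal.coe_le_coe_iff, div_le_iff₀ htpos]
  linarith

theorem mainTheorem5 {E F : ℕ → Type*}
    [∀ i, NormedAddCommGroup (E i)] [∀ i, NormedSpace ℝ (E i)] [∀ i, FiniteDimensional ℝ (E i)]
    [∀ i, NormedAddCommGroup (F i)] [∀ i, NormedSpace ℝ (F i)] [∀ i, FiniteDimensional ℝ (F i)]
    (N : InfiniteNetwork E F) (hN : N.WellPosed)
    (V : ∀ i, E i → ℝ≥0) (ψ₁ ψ₂ : ℝ≥0 → ℝ≥0) (γ : ℕ → ℕ → ℝ≥0 → ℝ≥0)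
    (γu : ℕ → ℝ≥0 → ℝ≥0) (α : ℝ≥0 → ℝ≥0)
    (hV : N.SubsystemLyapunov V ψ₁ ψ₂ γ γu α)
    (hγ : Equicontinuous fun p : ℕ × ℕ => γ p.1 p.2)
    (hγu : ∃ γmax, ClassK γmax ∧ ∀ i r, γu i r ≤ γmax r)
    (σ : ℝ≥0 → ℕ → ℝ≥0) (hσ : IsPathOfStrictDecay γ σ)
    (hLip : ∀ R : ℝ, 0 < R → ∃ L : ℝ, 0 < L ∧ ∀ i, ∀ x ∈ Metric.ball (0 : E i) R,
      ∀ y ∈ Metric.ball (0 : E i) R, dist (V i x) (V i y) ≤ L * ‖x - y‖) :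
    N.IsISS ∧
    (∀ x, BddAbove (range (scaledLyapunov V σ x))) ∧
    N.IsISSLyapunovFunction (networkLyapunov V σ) ∧
    ∀ x₀ : lp E ∞, x₀ ≠ 0 → ∃ δ L : ℝ, 0 < δ ∧ 0 < L ∧
      ∀ x₁ ∈ Metric.closedBall x₀ δ, ∀ x₂ ∈ Metric.closedBall x₀ δ,
        dist (networkLyapunov V σ x₁) (networkLyapunov V σ x₂) ≤ L * ‖x₁ - x₂‖ := by
  have hcont : Continuous (networkLyapunov V σ) :=
    continuous_networkLyapunov hσ hV.classKInf_upper (fun i x => (hV.coercive i x).2) hLip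
  obtain ⟨σmin, σmax, hmin, hmax, hb⟩ := hσ.bounds
  obtain ⟨χ, κ, hχ, hκ, hκle, hdec⟩ := hV.exists_decay hσ hcont hγu
  have hφ₁ := hmax.invFun.comp hV.classKInf_lower
  have hφ₂ := hmin.invFun.comp hV.classKInf_upper
  have hφ : ∀ x, Function.invFun σmax (ψ₁ ‖x‖₊) ≤ networkLyapunov V σ x ∧
      networkLyapunov V σ x ≤ Function.invFun σmin (ψ₂ ‖x‖₊) := fun x =>
    ⟨le_networkLyapunov hσ.classKInf hmax (fun i r => (hb i r).2) hV.classKInf_lower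
      (fun i x => (hV.coercive i x).1) x (hV.bddAbove hσ x),
    networkLyapunov_le hσ.classKInf hmin (fun i r => (hb i r).1) hV.classKInf_upper
      (fun i x => (hV.coercive i x).2) x⟩
  refine ⟨hN.isISS_of_decay hcont hφ₁ hφ₂ hφ hχ hκ hκle hdec, hV.bddAbove hσ,
    ⟨hcont, ⟨_, _, hφ₁, hφ₂, hφ⟩, χ, κ, hχ, hκ, fun u hu x₀ T z hz hlt => ?_⟩,
    fun x₀ hx₀ => exists_dist_networkLyapunov_le hσ hV.classKInf_lower hV.classKInf_upper
      hV.coercive hLip hx₀⟩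
  have hz0 := hz.1.apply_zero
  have h := hdec u hu x₀ T z hz.1 0 (zero_mem_timeDomain hz.1.1) (by rwa [hz0])
  rw [hz0] at h
  refine upperDiniZero_le_of_eventually ?_
  simpa only [hz0, sub_zero] using h
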